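/- Let $0<B_L\le B_U\le M<\infty$, let $g\colon[0,\infty)\to[0,\infty)$ be continuous and nondecreasing, and let $Y_0,Y_1,\dots$ be i.i.d. transmission delays with $\Pr(Y_j\in[B_L,B_U])=1$. Put $D_0=0$, $R_0=-Y_0$, and for $j\ge 0$ let $R_{j+1}=D_j+Z_j$ (request points) and $D_{j+1}=R_{j+1}+Y_{j+1}$ (delivery points), where the waiting periods $Z_j\in[0,M]$ are chosen by a causal, possibly randomized, policy $\pi$, i.e. $Z_j$ is a (measurable) function of $Y_0,\dots,Y_j$ and of an independent random seed. The age of information is $\Delta(t)=t-\max\{R_j: D_j\le t\}$. For a query at time $Q>0$ let $$\bar h^{one}_{opt}(Q)=\inf_{\pi}E\big[g(\Delta(Q))\big],$$ the infimum being over all causal policies. A stationary deterministic policy is given by a measurable decision function $z$ through $Z_j=z(Y_j,Q-D_j)$. It is called a deterministic optimal policy for $Q$ if it attains $\bar h^{one}_{opt}(Q)$ and if, moreover, from every delivery point with remaining time $t\in[0,Q]$ until the query and age $y\in[B_L,B_U]$ no causal policy has a smaller expected age penalty at the query. For such a policy, $G_R(s,a)$ denotes the expected age penalty at the query when an update is requested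 with remaining time $s\ge0$ and current age $a\ge 0$, and the policy is followed afterwards. For $s\ge B_U$ this does not depend on $a$, and one writes $G_R(s)$. A border point is a request point $R\in[0,Q-B_U]$ with $G_R(Q-R)=\inf_{R'\in[0,Q-B_U]}G_R(Q-R')$. The selected border point is $Q^{BP}=Q-3B_U+z(B_L,3B_U)$, the request point that the policy determines at the delivery point $Q-3B_U$ with age $B_L$. Then there is a finite constant $\bar h^{one}_{opt}$, depending only on the law of the delays, $B_L$, $B_U$, $M$ and $g$, such that: (i) $\bar h^{one}_{opt}(Q)=\bar h^{one}_{opt}$ for every $Q>3B_U$. (ii) There is a decision function that is a deterministic optimal policy for every $Q>3B_U$ (so the infimum is a minimum) and satisfies $Q^{BP}\in[Q-3B_U,Q-B_U]$. (iii) For every $Q>3B_U$ and every deterministic optimal policy for $Q$: if $Q^{BP}\le Q-B_U$, then $Q^{BP}$ is a border point; every border point $R$, in particular $R=Q^{BP}$ in that case, satisfies $G_R(Q-R)=\bar h^{one}_{opt}$; and also when merely $Q^{BP}\le Q$ one has $G_R\big(Q-Q^{BP},\,B_L+Q^{BP}-(Q-3B_U)\big)=\bar h^{one}_{opt}$. (iv)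 For a given decision function, $Q-Q^{BP}$ is the same for all $Q>3B_U$. -/

import Mathlib

open MeasureTheory Set
open scoped NNReal ENNReal

noncomputable section

namespace PullOrWait

/-! ### Sample paths

A sample path is given by the transmission delays `Y 0, Y 1, ...` and the waiting periods
`Z 0, Z 1, ...`.  Time starts at the delivery of update `0`, whose age is then `Y 0`. -/

/-- The delivery points: `D 0 = 0` and `D (j + 1) = D j + Z j + Y (j + 1)`. -/
def deliveryTime (Z Y : ℕ → ℝ) : ℕ → ℝ
  | 0 => 0
  | j + 1 => deliveryTime Z Y j + Z j + Y (j + 1)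

/-- The request points: `R (j + 1) = D j + Z j`, and `R 0 = - Y 0`, so that `D j = R j + Y j`
for all `j`. -/
def requestTime (Z Y : ℕ → ℝ) : ℕ → ℝ
  | 0 => - Y 0
  | j + 1 => deliveryTime Z Y j + Z j

/-- Generation time of the freshest update delivered by time `t`:
`U t = max {R j | D j ≤ t}`. -/
def lastGeneration (Z Y : ℕ → ℝ) (t : ℝ) : ℝ :=
  sSup {r | ∃ j, deliveryTime Z Y j ≤ t ∧ r = requestTime Z Y j}

/-- The age of information `Δ t = t - U t`. -/
def age (Z Y : ℕ → ℝ) (t : ℝ) : ℝ := t - lastGeneration Z Y t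

/-! ### Policies -/

/-- A causal, possibly randomized, update policy with waiting periods in `[0, M]`.
The waiting period `Z j` is a measurable function of a random seed (uniform on `[0, 1]` and
independent of the delays) and of the delays `Y 0, ..., Y j` observed up to the delivery of
update `j`; through these it may depend on the earlier waiting periods. -/
structure CausalPolicy (M : ℝ) where
  wait : ℕ → unitInterval → (ℕ → ℝ) → ℝ
  measurable_wait : ∀ j, Measurable fun p : unitInterval × (ℕ → ℝ) => wait j p.1 p.2
  wait_mem : ∀ j θ Y, wait j θ Y ∈ Icc 0 M
  causal : ∀ j θ (Y Y' : ℕ → ℝ), (∀ i ≤ j, Y i = Y' i) → wait j θ Y = wait j θ Y'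

/-- A stationary deterministic policy, given by its decision function `z`: the waiting period
after the delivery of update `j` is `z (Y j) (Q - D j)`. -/
structure SDPolicy (M : ℝ) where
  z : ℝ → ℝ → ℝ
  measurable_z : Measurable fun p : ℝ × ℝ => z p.1 p.2
  z_mem : ∀ y t, z y t ∈ Icc 0 M

/-- The delivery points for the query time `Q` when the decision function `ζ j` is used at the
`j`-th delivery. -/
def loopDelivery {M : ℝ} (ζ : ℕ → SDPolicy M) (Q : ℝ) (Y : ℕ → ℝ) : ℕ → ℝ
  | 0 => 0
  | j + 1 => loopDelivery ζ Q Y j + (ζ j).z (Y j) (Q - loopDelivery ζ Q Y j) + Y (j + 1)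

lemma loopDelivery_congr {M : ℝ} (ζ : ℕ → SDPolicy M) (Q : ℝ) {Y Y' : ℕ → ℝ} :
    ∀ j, (∀ i ≤ j, Y i = Y' i) → loopDelivery ζ Q Y j = loopDelivery ζ Q Y' j
  | 0, _ => rfl
  | j + 1, h => by
    have ih := loopDelivery_congr ζ Q j fun i hi => h i (by omega)
    simp only [loopDelivery, ih, h j (by omega), h (j + 1) le_rfl]

lemma measurable_loopDelivery {M : ℝ} (ζ : ℕ → SDPolicy M) (Q : ℝ) :
    ∀ j, Measurable fun Y : ℕ → ℝ => loopDelivery ζ Q Y j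
  | 0 => measurable_const
  | j + 1 => by
    have ih := measurable_loopDelivery ζ Q j
    have h := (ζ j).measurable_z.comp
      ((measurable_pi_apply j).prodMk (ih.const_sub Q) : Measurable
        fun Y : ℕ → ℝ => (Y j, Q - loopDelivery ζ Q Y j))
    exact (ih.add h).add (measurable_pi_apply (j + 1))

/-- The causal policy for the query time `Q` that uses the decision function `ζ j` at the `j`-th
delivery: `Z j = ζ j (Y j) (Q - D j)`. -/
def CausalPolicy.ofRules {M : ℝ} (ζ : ℕ → SDPolicy M) (Q : ℝ) : CausalPolicy M where
  wait j _ Y := (ζ j).z (Y j) (Q - loopDelivery ζ Q Y j)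
  measurable_wait j :=
    ((ζ j).measurable_z.comp
      ((measurable_pi_apply j).prodMk ((measurable_loopDelivery ζ Q j).const_sub Q) : Measurable
        fun Y : ℕ → ℝ => (Y j, Q - loopDelivery ζ Q Y j))).comp measurable_snd
  wait_mem j _ Y := (ζ j).z_mem _ _
  causal j _ Y Y' h := by rw [loopDelivery_congr ζ Q j h, h j le_rfl]

/-- The stationary deterministic policy `z` as a causal policy for the query time `Q`. -/
def SDPolicy.toCausal {M : ℝ} (z : SDPolicy M) (Q : ℝ) : CausalPolicy M :=
  CausalPolicy.ofRules (fun _ => z) Q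

/-- The zero-wait rule. -/
def SDPolicy.noWait {M : ℝ} (hM : 0 ≤ M) : SDPolicy M where
  z _ _ := 0
  measurable_z := measurable_const
  z_mem _ _ := ⟨le_rfl, hM⟩

lemma SDPolicy.bound_nonneg {M : ℝ} (z : SDPolicy M) : 0 ≤ M :=
  (z.z_mem 0 0).1.trans (z.z_mem 0 0).2

/-- The policy that requests at time `0` and from the next delivery on follows `z`. -/
def SDPolicy.requestNow {M : ℝ} (z : SDPolicy M) (Q : ℝ) : CausalPolicy M :=
  CausalPolicy.ofRules (fun j => if j = 0 then SDPolicy.noWait z.bound_nonneg else z) Q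

/-! ### Costs

`μ` is the law of a transmission delay and `g` is the age penalty function.  The delays are
i.i.d. with law `μ`, the seed is uniform on `[0, 1]` and independent of them. -/

/-- The age penalty at the query time `Q` under the policy `π`, for given seed and delays. -/
def penalty {M : ℝ} (g : ℝ≥0 → ℝ≥0) (π : CausalPolicy M) (Q : ℝ) (θ : unitInterval)
    (Y : ℕ → ℝ) : ℝ≥0 :=
  g (age (fun j => π.wait j θ Y) Y Q).toNNReal

/-- The expected age penalty `E[g(Δ(Q))]` under the policy `π`. -/
def expectedPenalty {M : ℝ} (μ : Measure ℝ) [IsProbabilityMeasure μ] (g : ℝ≥0 → ℝ≥0)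
    (π : CausalPolicy M) (Q : ℝ) : ℝ≥0∞ :=
  ∫⁻ θ : unitInterval, ∫⁻ Y, (penalty g π Q θ Y : ℝ≥0∞) ∂(Measure.infinitePi fun _ : ℕ => μ)

/-- The expected age penalty `E[g(Δ(Q)) | Y 0 = y]` when the age at the initial delivery point
is `y`. -/
def expectedPenaltyFrom {M : ℝ} (μ : Measure ℝ) [IsProbabilityMeasure μ] (g : ℝ≥0 → ℝ≥0)
    (π : CausalPolicy M) (Q y : ℝ) : ℝ≥0∞ :=
  ∫⁻ θ : unitInterval, ∫⁻ Y, (penalty g π Q θ (Function.update Y 0 y) : ℝ≥0∞)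
    ∂(Measure.infinitePi fun _ : ℕ => μ)

/-- The optimal value of the single query problem with query time `Q`, over all causal
policies. -/
def singleQueryOpt (μ : Measure ℝ) [IsProbabilityMeasure μ] (g : ℝ≥0 → ℝ≥0) (M Q : ℝ) : ℝ≥0∞ :=
  ⨅ π : CausalPolicy M, expectedPenalty μ g π Q

/-- `costD μ g z t y` is the expected age penalty at the query when `z` is applied from a delivery
point on at which the remaining time until the query is `t` and the age is `y`.  (Time is counted
from that delivery point; the later delays are independent of the past.) -/
def costD {M : ℝ} (μ : Measure ℝ) [IsProbabilityMeasure μ] (g : ℝ≥0 → ℝ≥0)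
    (z : SDPolicy M) (t y : ℝ) : ℝ≥0∞ :=
  expectedPenaltyFrom μ g (z.toCausal t) t y

/-- `costR μ g z s a` is the expected age penalty at the query when an update is requested at a
point at which the remaining time until the query is `s ≥ 0` and the age is `a`, and `z` is applied
from its delivery on.  (Time is counted from that request point.) -/
def costR {M : ℝ} (μ : Measure ℝ) [IsProbabilityMeasure μ] (g : ℝ≥0 → ℝ≥0)
    (z : SDPolicy M) (s a : ℝ) : ℝ≥0∞ :=
  expectedPenaltyFrom μ g (z.requestNow s) s a

/-- `z` is a deterministic optimal policy for the query time `Q`: it attains the optimal value of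
the single query problem, and at every delivery point before the query, with remaining time
`t ∈ [0, Q]` and age `y ∈ [B_L, B_U]`, no causal policy has a smaller expected age penalty. -/
def IsOptimal {M : ℝ} (μ : Measure ℝ) [IsProbabilityMeasure μ] (g : ℝ≥0 → ℝ≥0)
    (B_L B_U Q : ℝ) (z : SDPolicy M) : Prop :=
  expectedPenalty μ g (z.toCausal Q) Q = singleQueryOpt μ g M Q ∧
  ∀ t ∈ Icc 0 Q, ∀ y ∈ Icc B_L B_U, ∀ π : CausalPolicy M,
    costD μ g z t y ≤ expectedPenaltyFrom μ g π t y

/-- `R` is a border point of the query time `Q` and the policy `z`: it minimizes the expected age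
penalty among the request points in `[0, Q - B_U]`.  (The age at such a request point is
immaterial.) -/
def IsBorderPoint {M : ℝ} (μ : Measure ℝ) [IsProbabilityMeasure μ] (g : ℝ≥0 → ℝ≥0)
    (B_U Q : ℝ) (z : SDPolicy M) (R : ℝ) : Prop :=
  R ∈ Icc 0 (Q - B_U) ∧ ∀ a, 0 ≤ a →
    costR μ g z (Q - R) a = ⨅ R' ∈ Icc 0 (Q - B_U), costR μ g z (Q - R') a

/-- The selected border point: the request point that `z` determines at a delivery point
`Q - 3 B_U` at which the age is `B_L`. -/
def borderPoint {M : ℝ} (B_L B_U Q : ℝ) (z : SDPolicy M) : ℝ :=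
  Q - 3 * B_U + z.z B_L (3 * B_U)

end PullOrWait

end

/-! An update requested with remaining time `s ≥ B_U` surely arrives before the query, so its
expected penalty depends on `s` alone: the age at the request is forgotten. The constant sought is
`borderCost`, the least such cost over `s` in `[B_U, 2 B_U]`. The key fact is that the optimal
cost-to-go equals it at every delivery with remaining time at least `2 B_U` (`value_eq_borderCost`).

It is attainable: request without waiting until the desired request point is at most `B_U` away,
which delays of at most `B_U` cannot overshoot, and then wait for it, as `B_U ≤ M` permits
(`value_le_requestCost`). It cannot be beaten: a policy that jumps over the window makes a request
with `s < B_U` and faces an age of at least `2 B_U` if that update is late. Requesting at `s + B_U`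
and again at `s` leaves only the age `s + B_U` in that case (`requestCost_add_le`,
`borderCost_le_of_lt`).

The cost-to-go is the dynamic programming `value`. Delays are at least `B_L > 0`, so boundedly many
deliveries precede the query, and the recursions become inductions on that bound. Lower
semicontinuity yields attained minima and a measurable greedy rule (`exists_greedy`);
`value_le_rulePenalty` compares `value` with every causal policy. With `3 B_U` left, an immediate
request is delivered with at least `2 B_U` left and so costs exactly `borderCost`; the greedy rule
with the smallest waiting period therefore does not wait there. For any optimal policy, the cost at
this delivery point is the cost of the request it makes, provided that request is not after the
query. -/

noncomputable section

namespace PullOrWait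

/-! ### Prepending a delay to a sequence of delays -/

/-- The sequence that starts with `x` and continues with `Y`. -/
def prepend (x : ℝ) (Y : ℕ → ℝ) : ℕ → ℝ
  | 0 => x
  | j + 1 => Y j

@[simp] lemma prepend_zero (x : ℝ) (Y : ℕ → ℝ) : prepend x Y 0 = x := rfl

@[simp] lemma prepend_succ (x : ℝ) (Y : ℕ → ℝ) (j : ℕ) : prepend x Y (j + 1) = Y j := rfl

lemma measurable_prepend : Measurable fun p : ℝ × (ℕ → ℝ) => prepend p.1 p.2 := by
  refine measurable_pi_lambda _ fun j => ?_
  cases j with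
  | zero => exact measurable_fst
  | succ j => exact (measurable_pi_apply j).comp measurable_snd

lemma measurable_prepend_right (x : ℝ) : Measurable (prepend x) :=
  measurable_prepend.comp measurable_prodMk_left

lemma update_eq_prepend (Y : ℕ → ℝ) (y : ℝ) :
    Function.update Y 0 y = prepend y fun j => Y (j + 1) := by
  funext j
  cases j <;> simp

/-- The law of an i.i.d. sequence of delays. -/
abbrev seqLaw (μ : Measure ℝ) [IsProbabilityMeasure μ] : Measure (ℕ → ℝ) :=
  Measure.infinitePi fun _ : ℕ => μ

/-- A product measure is determined by its finite cylinders, so these suffice. This splits off the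
first delay, the probabilistic half of every first-step decomposition below. -/
lemma map_prepend (μ : Measure ℝ) [IsProbabilityMeasure μ] :
    (μ.prod (seqLaw μ)).map (fun p => prepend p.1 p.2) = seqLaw μ := by
  refine Measure.eq_infinitePi (fun _ : ℕ => μ) fun s t ht => ?_
  classical
  obtain ⟨n, hn⟩ := s.exists_nat_subset_range
  -- Enlarging the index set to an initial segment containing `0` makes the preimage of the cylinder
  -- a product set.
  set t' : ℕ → Set ℝ := fun i => if i ∈ s then t i else univ with ht'
  have ht'm : ∀ i, MeasurableSet (t' i) := fun i => by
    by_cases hi : i ∈ s <;> simp [ht', hi, ht]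
  have hset : (s : Set ℕ).pi t = ((Finset.range (n + 1) : Finset ℕ) : Set ℕ).pi t' := by
    ext Y
    simp only [Set.mem_pi, Finset.mem_coe, ht']
    constructor
    · intro h i _
      split_ifs with his
      · exact h i his
      · trivial
    · intro h i hi
      have := h i (Finset.range_subset_range.2 (Nat.le_succ n) (hn hi))
      rwa [if_pos hi] at this
  have hprod : ∏ i ∈ s, μ (t i) = ∏ i ∈ Finset.range (n + 1), μ (t' i) := by
    rw [← Finset.prod_subset (hn.trans (Finset.range_subset_range.2 (Nat.le_succ n)))]
    · exact Finset.prod_congr rfl fun i hi => by simp [ht', hi]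
    · intro i _ hi
      simp [ht', hi]
  have hpre : (fun p : ℝ × (ℕ → ℝ) => prepend p.1 p.2) ⁻¹'
      ((Finset.range (n + 1) : Finset ℕ) : Set ℕ).pi t' =
      t' 0 ×ˢ ((Finset.range n : Finset ℕ) : Set ℕ).pi fun i => t' (i + 1) := by
    ext p
    simp only [Set.mem_preimage, Set.mem_pi, Finset.mem_coe, Finset.mem_range, Set.mem_prod]
    constructor
    · exact fun h => ⟨h 0 (Nat.succ_pos n), fun i hi => h (i + 1) (by omega)⟩
    · rintro ⟨h0, h1⟩ i hi
      cases i with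
      | zero => exact h0
      | succ i => exact h1 i (by omega)
  rw [hset, hprod, Measure.map_apply measurable_prepend
    (MeasurableSet.pi (Finset.countable_toSet _) fun i _ => ht'm i), hpre, Measure.prod_prod,
    Measure.infinitePi_pi _ (fun i _ => ht'm (i + 1)), Finset.prod_range_succ', mul_comm]

lemma lintegral_seqLaw (μ : Measure ℝ) [IsProbabilityMeasure μ] {f : (ℕ → ℝ) → ℝ≥0∞}
    (hf : Measurable f) :
    ∫⁻ Y, f Y ∂seqLaw μ = ∫⁻ x, ∫⁻ Y, f (prepend x Y) ∂seqLaw μ ∂μ := by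
  conv_lhs => rw [← map_prepend μ]
  rw [lintegral_map hf measurable_prepend,
    lintegral_prod (fun p : ℝ × (ℕ → ℝ) => f (prepend p.1 p.2))
      (hf.comp measurable_prepend).aemeasurable]

lemma lintegral_seqLaw_update (μ : Measure ℝ) [IsProbabilityMeasure μ] {f : (ℕ → ℝ) → ℝ≥0∞}
    (hf : Measurable f) (y : ℝ) :
    ∫⁻ Y, f (Function.update Y 0 y) ∂seqLaw μ = ∫⁻ Y, f (prepend y Y) ∂seqLaw μ := by
  have h : Measurable fun Y : ℕ → ℝ => f (Function.update Y 0 y) :=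
    hf.comp (measurable_update_left)
  rw [lintegral_seqLaw μ h]
  simp [update_eq_prepend]

lemma ae_seqLaw {μ : Measure ℝ} [IsProbabilityMeasure μ] {p : ℝ → Prop}
    (h : ∀ᵐ x ∂μ, p x) : ∀ᵐ Y ∂seqLaw μ, ∀ j, p (Y j) :=
  ae_all_iff.2 fun j =>
    (measurePreserving_eval_infinitePi (fun _ : ℕ => μ) j).quasiMeasurePreserving.ae h

/-! ### First-step decomposition of sample paths -/

lemma deliveryTime_nonneg {Z Y : ℕ → ℝ} (hZ : ∀ j, 0 ≤ Z j) (hY : ∀ j, 0 ≤ Y (j + 1)) :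
    ∀ j, 0 ≤ deliveryTime Z Y j
  | 0 => le_rfl
  | j + 1 => add_nonneg (add_nonneg (deliveryTime_nonneg hZ hY j) (hZ j)) (hY j)

lemma deliveryTime_succ' (Z Y : ℕ → ℝ) (j : ℕ) :
    deliveryTime Z Y (j + 1) =
      Z 0 + Y 1 + deliveryTime (fun i => Z (i + 1)) (fun i => Y (i + 1)) j := by
  induction j with
  | zero => simp [deliveryTime]
  | succ j ih =>
    rw [deliveryTime, ih, deliveryTime]
    ring

lemma requestTime_succ' (Z Y : ℕ → ℝ) (j : ℕ) :
    requestTime Z Y (j + 1) =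
      Z 0 + Y 1 + requestTime (fun i => Z (i + 1)) (fun i => Y (i + 1)) j := by
  cases j with
  | zero => simp [requestTime, deliveryTime]
  | succ j =>
    rw [requestTime, deliveryTime_succ', requestTime]
    ring

lemma requestTime_le_deliveryTime {Z Y : ℕ → ℝ} (hY : ∀ j, 0 ≤ Y j) (j : ℕ) :
    requestTime Z Y j ≤ deliveryTime Z Y j := by
  cases j with
  | zero => simpa [requestTime, deliveryTime] using hY 0
  | succ j => simpa [requestTime, deliveryTime] using hY (j + 1)

lemma bddAbove_requestTime {Z Y : ℕ → ℝ} (hY : ∀ j, 0 ≤ Y j) (t : ℝ) :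
    BddAbove {r | ∃ j, deliveryTime Z Y j ≤ t ∧ r = requestTime Z Y j} := by
  refine ⟨t, ?_⟩
  rintro r ⟨j, hj, rfl⟩
  exact (requestTime_le_deliveryTime hY j).trans hj

lemma requestSet_eq {Z Y : ℕ → ℝ} {t : ℝ} (ht : 0 ≤ t) :
    {r | ∃ j, deliveryTime Z Y j ≤ t ∧ r = requestTime Z Y j} =
      insert (-Y 0) ((fun r => Z 0 + Y 1 + r) ''
        {r | ∃ j, deliveryTime (fun i => Z (i + 1)) (fun i => Y (i + 1)) j ≤ t - (Z 0 + Y 1) ∧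
          r = requestTime (fun i => Z (i + 1)) (fun i => Y (i + 1)) j}) := by
  ext r
  constructor
  · rintro ⟨j, hj, rfl⟩
    cases j with
    | zero => exact Or.inl rfl
    | succ j =>
      rw [deliveryTime_succ'] at hj
      exact Or.inr ⟨_, ⟨j, by linarith, rfl⟩, (requestTime_succ' Z Y j).symm⟩
  · rintro (rfl | ⟨_, ⟨j, hj, rfl⟩, rfl⟩)
    · exact ⟨0, ht, rfl⟩
    · exact ⟨j + 1, by rw [deliveryTime_succ']; linarith, (requestTime_succ' Z Y j).symm⟩

/-- Once update `1` is delivered, update `0` no longer matters: its request point `-Y 0` is not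
later than `Z 0`. The clock can be restarted at that delivery. -/
lemma age_of_le {Z Y : ℕ → ℝ} {t : ℝ} (hZ : ∀ j, 0 ≤ Z j) (hY : ∀ j, 0 ≤ Y j)
    (h : Z 0 + Y 1 ≤ t) :
    age Z Y t = age (fun i => Z (i + 1)) (fun i => Y (i + 1)) (t - (Z 0 + Y 1)) := by
  have ht : 0 ≤ t := (add_nonneg (hZ 0) (hY 1)).trans h
  set S := {r | ∃ j, deliveryTime (fun i => Z (i + 1)) (fun i => Y (i + 1)) j ≤
    t - (Z 0 + Y 1) ∧ r = requestTime (fun i => Z (i + 1)) (fun i => Y (i + 1)) j} with hS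
  have hne : -Y 1 ∈ S := ⟨0, by simpa [deliveryTime] using h, rfl⟩
  have hbdd : BddAbove S := bddAbove_requestTime (fun j => hY (j + 1)) _
  have himage : sSup ((fun r => Z 0 + Y 1 + r) '' S) = Z 0 + Y 1 + sSup S :=
    ((OrderIso.addLeft (Z 0 + Y 1)).map_csSup' ⟨_, hne⟩ hbdd).symm
  have hbdd' : BddAbove ((fun r => Z 0 + Y 1 + r) '' S) :=
    Monotone.map_bddAbove (fun a b hab => add_le_add_right hab _) hbdd
  have hle : -Y 0 ≤ Z 0 + Y 1 + sSup S := by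
    linarith [le_csSup hbdd hne, hZ 0, hY 0]
  rw [age, age, lastGeneration, lastGeneration, requestSet_eq ht, ← hS,
    csSup_insert hbdd' ⟨_, mem_image_of_mem _ hne⟩, himage, sup_eq_right.2 hle]
  ring

lemma age_of_lt {Z Y : ℕ → ℝ} {t : ℝ} (hZ : ∀ j, 0 ≤ Z j) (hY : ∀ j, 0 ≤ Y j) (ht : 0 ≤ t)
    (h : t < Z 0 + Y 1) : age Z Y t = Y 0 + t := by
  have hempty : {r | ∃ j, deliveryTime (fun i => Z (i + 1)) (fun i => Y (i + 1)) j ≤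
      t - (Z 0 + Y 1) ∧ r = requestTime (fun i => Z (i + 1)) (fun i => Y (i + 1)) j} = ∅ := by
    refine eq_empty_of_forall_notMem ?_
    rintro r ⟨j, hj, -⟩
    have := deliveryTime_nonneg (Z := fun i => Z (i + 1)) (Y := fun i => Y (i + 1))
      (fun j => hZ (j + 1)) (fun j => hY (j + 1 + 1)) j
    linarith
  rw [age, lastGeneration, requestSet_eq ht, hempty, image_empty, insert_empty_eq,
    csSup_singleton]
  ring

/-! ### Deterministic waiting rules -/

/-- A waiting rule that may use the whole history of delays, but no randomization. -/
structure IsWaitRule (M : ℝ) (w : ℕ → (ℕ → ℝ) → ℝ) : Prop where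
  measurable : ∀ j, Measurable (w j)
  mem : ∀ j Y, w j Y ∈ Icc 0 M
  causal : ∀ j (Y Y' : ℕ → ℝ), (∀ i ≤ j, Y i = Y' i) → w j Y = w j Y'

lemma CausalPolicy.isWaitRule {M : ℝ} (π : CausalPolicy M) (θ : unitInterval) :
    IsWaitRule M fun j => π.wait j θ where
  measurable j := (π.measurable_wait j).comp measurable_prodMk_left
  mem j := π.wait_mem j θ
  causal j := π.causal j θ

/-- The waiting rule that remains after a first delay `y` has been observed. -/
def restRule (w : ℕ → (ℕ → ℝ) → ℝ) (y : ℝ) : ℕ → (ℕ → ℝ) → ℝ :=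
  fun j Y => w (j + 1) (prepend y Y)

lemma IsWaitRule.rest {M : ℝ} {w : ℕ → (ℕ → ℝ) → ℝ} (hw : IsWaitRule M w) (y : ℝ) :
    IsWaitRule M (restRule w y) where
  measurable j := (hw.measurable (j + 1)).comp (measurable_prepend_right y)
  mem j Y := hw.mem (j + 1) _
  causal j Y Y' h := hw.causal (j + 1) _ _ fun i hi => by
    cases i with
    | zero => rfl
    | succ i => exact h i (by omega)

/-- The penalty for an age given as a real number. -/
def agePenalty (g : ℝ≥0 → ℝ≥0) (r : ℝ) : ℝ≥0∞ := g r.toNNReal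

/-- The penalty at time `t` under the waiting rule `w` for given delays. -/
def pathPenalty (g : ℝ≥0 → ℝ≥0) (w : ℕ → (ℕ → ℝ) → ℝ) (t : ℝ) (Y : ℕ → ℝ) : ℝ≥0∞ :=
  agePenalty g (age (fun j => w j Y) Y t)

/-- The expected penalty at time `t` under the waiting rule `w` when the first delay is `y`. -/
def rulePenalty (μ : Measure ℝ) [IsProbabilityMeasure μ] (g : ℝ≥0 → ℝ≥0)
    (w : ℕ → (ℕ → ℝ) → ℝ) (t y : ℝ) : ℝ≥0∞ :=
  ∫⁻ Y, pathPenalty g w t (prepend y Y) ∂seqLaw μ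

lemma measurable_deliveryTime {M : ℝ} {w : ℕ → (ℕ → ℝ) → ℝ} (hw : IsWaitRule M w) :
    ∀ j, Measurable fun Y : ℕ → ℝ => deliveryTime (fun i => w i Y) Y j
  | 0 => measurable_const
  | j + 1 =>
    ((measurable_deliveryTime hw j).add (hw.measurable j)).add (measurable_pi_apply (j + 1))

lemma measurable_requestTime {M : ℝ} {w : ℕ → (ℕ → ℝ) → ℝ} (hw : IsWaitRule M w) :
    ∀ j, Measurable fun Y : ℕ → ℝ => requestTime (fun i => w i Y) Y j
  | 0 => (measurable_pi_apply 0).neg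
  | j + 1 => (measurable_deliveryTime hw j).add (hw.measurable j)

lemma measurable_age {M : ℝ} {w : ℕ → (ℕ → ℝ) → ℝ} (hw : IsWaitRule M w) {t : ℝ} (ht : 0 ≤ t) :
    Measurable fun Y : ℕ → ℝ => age (fun j => w j Y) Y t := by
  -- Undelivered updates are assigned the value `-Y 0`, which belongs to the set anyway because `0 ≤
  -- t`. The supremum becomes a countable one of measurable functions.
  have h : ∀ Y : ℕ → ℝ, lastGeneration (fun j => w j Y) Y t =
      ⨆ j, if deliveryTime (fun i => w i Y) Y j ≤ t then requestTime (fun i => w i Y) Y j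
        else -Y 0 := fun Y => by
    rw [lastGeneration, iSup]
    congr 1
    ext r
    constructor
    · rintro ⟨j, hj, rfl⟩
      exact ⟨j, if_pos hj⟩
    · rintro ⟨j, rfl⟩
      dsimp only
      split_ifs with hj
      · exact ⟨j, hj, rfl⟩
      · exact ⟨0, ht, rfl⟩
  simp only [age, h]
  exact (Measurable.iSup fun j => Measurable.ite
    (measurableSet_le (measurable_deliveryTime hw j) measurable_const)
    (measurable_requestTime hw j) (measurable_pi_apply 0).neg).const_sub t

lemma measurable_pathPenalty {M : ℝ} {g : ℝ≥0 → ℝ≥0} (hg : Continuous g)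
    {w : ℕ → (ℕ → ℝ) → ℝ} (hw : IsWaitRule M w) {t : ℝ} (ht : 0 ≤ t) :
    Measurable (pathPenalty g w t) :=
  ((hg.measurable.comp measurable_real_toNNReal).coe_nnreal_ennreal).comp (measurable_age hw ht)

/-- By causality the first waiting period depends on `y` only, so the continuation `Y'` is an
arbitrary placeholder that keeps it outside the integrals. -/
lemma pathPenalty_prepend {M : ℝ} {g : ℝ≥0 → ℝ≥0} {w : ℕ → (ℕ → ℝ) → ℝ} (hw : IsWaitRule M w)
    {t y x : ℝ} (ht : 0 ≤ t) (hy : 0 ≤ y) (hx : 0 ≤ x) {Y Y' : ℕ → ℝ} (hY : ∀ j, 0 ≤ Y j) :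
    pathPenalty g w t (prepend y (prepend x Y)) =
      if x ≤ t - w 0 (prepend y Y') then
        pathPenalty g (restRule w y) (t - w 0 (prepend y Y') - x) (prepend x Y)
      else agePenalty g (y + t) := by
  have h0 : w 0 (prepend y Y') = w 0 (prepend y (prepend x Y)) :=
    hw.causal 0 _ _ fun i hi => by
      obtain rfl : i = 0 := by omega
      rfl
  have hZ : ∀ j, 0 ≤ w j (prepend y (prepend x Y)) := fun j => (hw.mem j _).1
  have hYY : ∀ j, 0 ≤ prepend y (prepend x Y) j := by
    rintro (_ | _ | j)
    exacts [hy, hx, hY j]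
  rw [h0, pathPenalty, pathPenalty]
  split_ifs with h
  · rw [age_of_le hZ hYY (by simpa using (by linarith))]
    congr 2
    simp only [prepend_succ, prepend_zero]
    ring
  · rw [age_of_lt hZ hYY ht (by simpa using (by linarith))]
    simp

/-- First-step decomposition of the expected penalty. -/
lemma rulePenalty_eq {M : ℝ} (μ : Measure ℝ) [IsProbabilityMeasure μ] {g : ℝ≥0 → ℝ≥0}
    (hg : Continuous g) (hμ : ∀ᵐ x ∂μ, 0 ≤ x) {w : ℕ → (ℕ → ℝ) → ℝ} (hw : IsWaitRule M w)
    {t y : ℝ} (ht : 0 ≤ t) (hy : 0 ≤ y) (Y' : ℕ → ℝ) :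
    rulePenalty μ g w t y = ∫⁻ x, (if x ≤ t - w 0 (prepend y Y') then
        rulePenalty μ g (restRule w y) (t - w 0 (prepend y Y') - x) x
      else agePenalty g (y + t)) ∂μ := by
  rw [rulePenalty, lintegral_seqLaw μ (f := fun Y => pathPenalty g w t (prepend y Y))
    ((measurable_pathPenalty hg hw ht).comp (measurable_prepend_right y))]
  refine lintegral_congr_ae ?_
  filter_upwards [hμ] with x hx
  have h : ∀ᵐ Y ∂seqLaw μ, pathPenalty g w t (prepend y (prepend x Y)) =
      if x ≤ t - w 0 (prepend y Y') then
        pathPenalty g (restRule w y) (t - w 0 (prepend y Y') - x) (prepend x Y)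
      else agePenalty g (y + t) := by
    filter_upwards [ae_seqLaw hμ] with Y hY
    exact pathPenalty_prepend hw ht hy hx hY
  rw [lintegral_congr_ae h]
  split_ifs with hxt
  · rfl
  · simp

lemma expectedPenaltyFrom_eq {M : ℝ} (μ : Measure ℝ) [IsProbabilityMeasure μ] {g : ℝ≥0 → ℝ≥0}
    (hg : Continuous g) (π : CausalPolicy M) {Q : ℝ} (hQ : 0 ≤ Q) (y : ℝ) :
    expectedPenaltyFrom μ g π Q y = ∫⁻ θ, rulePenalty μ g (fun j => π.wait j θ) Q y :=
  lintegral_congr fun θ =>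
    lintegral_seqLaw_update μ (measurable_pathPenalty hg (π.isWaitRule θ) hQ) y

lemma expectedPenalty_eq {M : ℝ} (μ : Measure ℝ) [IsProbabilityMeasure μ] {g : ℝ≥0 → ℝ≥0}
    (hg : Continuous g) (π : CausalPolicy M) {Q : ℝ} (hQ : 0 ≤ Q) :
    expectedPenalty μ g π Q = ∫⁻ θ, ∫⁻ y, rulePenalty μ g (fun j => π.wait j θ) Q y ∂μ :=
  lintegral_congr fun θ =>
    lintegral_seqLaw μ (measurable_pathPenalty hg (π.isWaitRule θ) hQ)

/-- The waiting rule that uses the decision function `ζ j` at the `j`-th delivery. -/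
def markovRule {M : ℝ} (ζ : ℕ → SDPolicy M) (Q : ℝ) : ℕ → (ℕ → ℝ) → ℝ :=
  fun j Y => (ζ j).z (Y j) (Q - loopDelivery ζ Q Y j)

lemma isWaitRule_markovRule {M : ℝ} (ζ : ℕ → SDPolicy M) (Q : ℝ) :
    IsWaitRule M (markovRule ζ Q) :=
  (CausalPolicy.ofRules ζ Q).isWaitRule 0

lemma expectedPenaltyFrom_ofRules {M : ℝ} (μ : Measure ℝ) [IsProbabilityMeasure μ]
    {g : ℝ≥0 → ℝ≥0} (hg : Continuous g) (ζ : ℕ → SDPolicy M) {Q : ℝ} (hQ : 0 ≤ Q) (y : ℝ) :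
    expectedPenaltyFrom μ g (CausalPolicy.ofRules ζ Q) Q y =
      rulePenalty μ g (markovRule ζ Q) Q y := by
  rw [expectedPenaltyFrom_eq μ hg _ hQ]
  exact (lintegral_const (rulePenalty μ g (markovRule ζ Q) Q y)).trans
    (by rw [measure_univ, mul_one])

lemma loopDelivery_prepend {M : ℝ} (ζ : ℕ → SDPolicy M) (Q y x : ℝ) (Y : ℕ → ℝ) (j : ℕ) :
    loopDelivery ζ Q (prepend y (prepend x Y)) (j + 1) =
      (ζ 0).z y Q + x +
        loopDelivery (fun i => ζ (i + 1)) (Q - (ζ 0).z y Q - x) (prepend x Y) j := by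
  induction j with
  | zero => simp [loopDelivery]
  | succ j ih =>
    have hQ : Q - ((ζ 0).z y Q + x +
        loopDelivery (fun i => ζ (i + 1)) (Q - (ζ 0).z y Q - x) (prepend x Y) j) =
        Q - (ζ 0).z y Q - x -
        loopDelivery (fun i => ζ (i + 1)) (Q - (ζ 0).z y Q - x) (prepend x Y) j := by ring
    rw [loopDelivery, ih, hQ, loopDelivery]
    simp only [prepend_succ]
    ring

/-- Decision functions see only the age and the remaining time, so the rule after a delivery is
again Markov. A sequence `ζ`, not a single function, is carried along because `requestNow` has an
exceptional first step. -/
lemma restRule_markovRule {M : ℝ} (ζ : ℕ → SDPolicy M) (Q y x : ℝ) (Y : ℕ → ℝ) (j : ℕ) :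
    restRule (markovRule ζ Q) y j (prepend x Y) =
      markovRule (fun i => ζ (i + 1)) (Q - (ζ 0).z y Q - x) j (prepend x Y) := by
  rw [restRule, markovRule, markovRule, loopDelivery_prepend, prepend_succ]
  congr 1
  ring

/-- First-step decomposition of the expected penalty of a Markov policy. -/
lemma rulePenalty_markovRule {M : ℝ} (μ : Measure ℝ) [IsProbabilityMeasure μ] {g : ℝ≥0 → ℝ≥0}
    (hg : Continuous g) (hμ : ∀ᵐ x ∂μ, 0 ≤ x) (ζ : ℕ → SDPolicy M) {t y : ℝ}
    (ht : 0 ≤ t) (hy : 0 ≤ y) :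
    rulePenalty μ g (markovRule ζ t) t y = ∫⁻ x, (if x ≤ t - (ζ 0).z y t then
        rulePenalty μ g (markovRule (fun i => ζ (i + 1)) (t - (ζ 0).z y t - x))
          (t - (ζ 0).z y t - x) x
      else agePenalty g (y + t)) ∂μ := by
  have h0 : markovRule ζ t 0 (prepend y 0) = (ζ 0).z y t := by
    simp [markovRule, loopDelivery]
  rw [rulePenalty_eq μ hg hμ (isWaitRule_markovRule ζ t) ht hy 0, h0]
  refine lintegral_congr fun x => ?_
  simp only [rulePenalty, pathPenalty, restRule_markovRule]

/-! ### Minimization of lower semicontinuous functions over a compact parameter -/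

lemma lowerSemicontinuous_biInf {X Z : Type*} [TopologicalSpace X] [TopologicalSpace Z]
    {Φ : X × Z → ℝ≥0∞} (hΦ : LowerSemicontinuous Φ) {K : Set Z} (hK : IsCompact K) :
    LowerSemicontinuous fun x => ⨅ z ∈ K, Φ (x, z) := by
  intro x c hc
  -- An infimum of values above a bound need not stay strictly above it; the room between `c` and
  -- `c'` restores strictness.
  obtain ⟨c', hcc', hc'⟩ := exists_between hc
  have h := hK.eventually_forall_of_forall_eventually (x₀ := x) (P := fun x z => c' < Φ (x, z))
    fun z hz => hΦ (x, z) c' (hc'.trans_le (iInf₂_le z hz))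
  filter_upwards [h] with x' hx'
  exact hcc'.trans_le (le_iInf₂ fun z hz => (hx' z hz).le)

lemma lowerSemicontinuous_section {X Z : Type*} [TopologicalSpace X] [TopologicalSpace Z]
    {Φ : X × Z → ℝ≥0∞} (hΦ : LowerSemicontinuous Φ) (x : X) :
    LowerSemicontinuous fun z => Φ (x, z) :=
  fun z c hc => ((Continuous.prodMk_right x).tendsto z).eventually (hΦ (x, z) c hc)

lemma exists_eq_biInf {Z : Type*} [TopologicalSpace Z] {φ : Z → ℝ≥0∞}
    (hφ : LowerSemicontinuous φ) {K : Set Z} (hK : IsCompact K) (hne : K.Nonempty) :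
    ∃ z ∈ K, φ z = ⨅ z ∈ K, φ z := by
  obtain ⟨z, hz, hmin⟩ := (hφ.lowerSemicontinuousOn K).exists_isMinOn hne hK
  exact ⟨z, hz, le_antisymm (le_iInf₂ fun z' hz' => hmin hz') (iInf₂_le z hz)⟩

/-- The smallest minimizer over a compact interval depends measurably on the parameter. -/
lemma exists_measurable_smallest_minimizer {X : Type*} [TopologicalSpace X] [MeasurableSpace X]
    [OpensMeasurableSpace X] {Φ : X × ℝ → ℝ≥0∞} (hΦ : LowerSemicontinuous Φ) {M : ℝ}
    (hM : 0 ≤ M) :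
    ∃ f : X → ℝ, Measurable f ∧ ∀ x, f x ∈ Icc 0 M ∧ Φ (x, f x) = ⨅ z ∈ Icc 0 M, Φ (x, z) ∧
      ∀ z ∈ Icc 0 M, Φ (x, z) ≤ ⨅ z ∈ Icc 0 M, Φ (x, z) → f x ≤ z := by
  set A : X → Set ℝ := fun x => Icc 0 M ∩
    (fun z => Φ (x, z)) ⁻¹' Iic (⨅ z ∈ Icc 0 M, Φ (x, z)) with hA
  have hcompact : ∀ x, IsCompact (A x) := fun x =>
    isCompact_Icc.inter_right ((lowerSemicontinuous_section hΦ x).isClosed_preimage _)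
  have hne : ∀ x, (A x).Nonempty := fun x => by
    obtain ⟨z, hz, h⟩ := exists_eq_biInf (lowerSemicontinuous_section hΦ x)
      (isCompact_Icc (a := (0 : ℝ)) (b := M)) (nonempty_Icc.2 hM)
    exact ⟨z, hz, h.le⟩
  have hmem : ∀ x, sInf (A x) ∈ A x := fun x => (hcompact x).sInf_mem (hne x)
  have hle : ∀ x, ∀ z ∈ A x, sInf (A x) ≤ z := fun x z hz => csInf_le (hcompact x).bddBelow hz
  refine ⟨fun x => sInf (A x), measurable_of_Iic fun c => ?_, fun x => ⟨(hmem x).1,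
    le_antisymm (hmem x).2 (iInf₂_le _ (hmem x).1), fun z hz h => hle x z ⟨hz, h⟩⟩⟩
  rcases lt_or_ge c 0 with hc | hc
  · convert MeasurableSet.empty
    exact eq_empty_of_forall_notMem fun x hx => (hx.trans_lt hc).not_ge (hmem x).1.1
  -- The smallest minimizer is at most `c` exactly when the minimum over `[0, min c M]` does not
  -- exceed the one over `[0, M]`; both minima are lower semicontinuous in `x`.
  · convert measurableSet_le
      (lowerSemicontinuous_biInf hΦ (isCompact_Icc (a := (0 : ℝ)) (b := min c M))).measurable
      (lowerSemicontinuous_biInf hΦ (isCompact_Icc (a := (0 : ℝ)) (b := M))).measurable using 1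
    ext x
    constructor
    · intro hx
      have hx' : sInf (A x) ∈ Icc 0 (min c M) := ⟨(hmem x).1.1, le_min hx (hmem x).1.2⟩
      have hΦx : Φ (x, sInf (A x)) ≤ ⨅ z ∈ Icc 0 M, Φ (x, z) := (hmem x).2
      exact (iInf₂_le (f := fun z _ => Φ (x, z)) (sInf (A x)) hx').trans hΦx
    · intro hx
      obtain ⟨z, hz, h⟩ := exists_eq_biInf (lowerSemicontinuous_section hΦ x)
        (isCompact_Icc (a := (0 : ℝ)) (b := min c M)) (nonempty_Icc.2 (le_min hc hM))
      exact (hle x z ⟨⟨hz.1, hz.2.trans (min_le_right _ _)⟩, h.le.trans hx⟩).trans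
        (hz.2.trans (min_le_left _ _))

/-! ### The dynamic program -/

lemma monotone_agePenalty {g : ℝ≥0 → ℝ≥0} (hg : Monotone g) : Monotone (agePenalty g) :=
  fun _ _ h => ENNReal.coe_le_coe.2 (hg (Real.toNNReal_le_toNNReal h))

lemma continuous_agePenalty {g : ℝ≥0 → ℝ≥0} (hg : Continuous g) : Continuous (agePenalty g) :=
  ENNReal.continuous_coe.comp (hg.comp continuous_real_toNNReal)

/-- The expected cost of a request with remaining time `s` if `F t y` is the cost-to-go at a
delivery with remaining time `t` and age `y`, and `τ` is the age that the query finds if the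
update is not delivered in time. -/
def requestCost (μ : Measure ℝ) (g : ℝ≥0 → ℝ≥0) (F : ℝ → ℝ → ℝ≥0∞) (s τ : ℝ) : ℝ≥0∞ :=
  ∫⁻ x, (if x ≤ s then F (s - x) x else agePenalty g (max τ s)) ∂μ

/-- Value iteration, started from zero. -/
def valueIter (μ : Measure ℝ) (g : ℝ≥0 → ℝ≥0) (M : ℝ) : ℕ → ℝ → ℝ → ℝ≥0∞
  | 0 => fun _ _ => 0
  | n + 1 => fun t y => ⨅ z ∈ Icc 0 M, requestCost μ g (valueIter μ g M n) (t - z) (y + t)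

/-- The optimal cost-to-go at a delivery with remaining time `t` and age `y`. -/
def value (μ : Measure ℝ) (g : ℝ≥0 → ℝ≥0) (M t y : ℝ) : ℝ≥0∞ :=
  ⨆ n, valueIter μ g M n t y

section

variable {μ : Measure ℝ} {g : ℝ≥0 → ℝ≥0} {B_L B_U M : ℝ}

lemma requestCost_mono (hμ : ∀ᵐ x ∂μ, x ∈ Icc B_L B_U) {F F' : ℝ → ℝ → ℝ≥0∞} {s τ : ℝ}
    (h : ∀ x ∈ Icc B_L B_U, x ≤ s → F (s - x) x ≤ F' (s - x) x) :
    requestCost μ g F s τ ≤ requestCost μ g F' s τ := by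
  refine lintegral_mono_ae ?_
  filter_upwards [hμ] with x hx
  split_ifs with hxs
  exacts [h x hx hxs, le_rfl]

lemma requestCost_congr (hμ : ∀ᵐ x ∂μ, x ∈ Icc B_L B_U) {F F' : ℝ → ℝ → ℝ≥0∞} {s τ : ℝ}
    (h : ∀ x ∈ Icc B_L B_U, x ≤ s → F (s - x) x = F' (s - x) x) :
    requestCost μ g F s τ = requestCost μ g F' s τ :=
  le_antisymm (requestCost_mono hμ fun x hx hs => (h x hx hs).le)
    (requestCost_mono hμ fun x hx hs => (h x hx hs).ge)

lemma requestCost_mono_age (hg : Monotone g) (F : ℝ → ℝ → ℝ≥0∞) (s : ℝ) :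
    Monotone (requestCost μ g F s) := by
  intro τ τ' h
  refine lintegral_mono fun x => ?_
  dsimp only
  split_ifs
  exacts [le_rfl, monotone_agePenalty hg (max_le_max_right s h)]

lemma requestCost_of_lt [IsProbabilityMeasure μ] (hμ : ∀ᵐ x ∂μ, x ∈ Icc B_L B_U)
    (F : ℝ → ℝ → ℝ≥0∞) {s τ : ℝ} (hs : s < B_L) (hτ : s ≤ τ) :
    requestCost μ g F s τ = agePenalty g τ := by
  have h : ∀ᵐ x ∂μ, (if x ≤ s then F (s - x) x else agePenalty g (max τ s)) = agePenalty g τ := by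
    filter_upwards [hμ] with x hx
    rw [if_neg (by linarith [hx.1]), max_eq_left hτ]
  rw [requestCost, lintegral_congr_ae h, lintegral_const, measure_univ, mul_one]

lemma requestCost_of_le (hμ : ∀ᵐ x ∂μ, x ∈ Icc B_L B_U) (F : ℝ → ℝ → ℝ≥0∞) {s : ℝ}
    (hs : B_U ≤ s) (τ : ℝ) : requestCost μ g F s τ = ∫⁻ x, F (s - x) x ∂μ := by
  refine lintegral_congr_ae ?_
  filter_upwards [hμ] with x hx
  rw [if_pos (hx.2.trans hs)]

lemma requestCost_const [IsProbabilityMeasure μ] (hμ : ∀ᵐ x ∂μ, x ∈ Icc B_L B_U)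
    {F : ℝ → ℝ → ℝ≥0∞} {s : ℝ} (hs : B_U ≤ s) (τ : ℝ) {h : ℝ≥0∞}
    (hF : ∀ x ∈ Icc B_L B_U, F (s - x) x = h) : requestCost μ g F s τ = h := by
  have h' : ∀ᵐ x ∂μ, F (s - x) x = h := by
    filter_upwards [hμ] with x hx using hF x hx
  rw [requestCost_of_le hμ F hs, lintegral_congr_ae h', lintegral_const, measure_univ, mul_one]

/-- The integrand can jump only where `x = s`, and `hF0` makes the value taken there the lower one;
the `max` in `requestCost` ensures this even for `τ < s`. Fatou's lemma passes lower semicontinuity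
to the integral. -/
lemma lowerSemicontinuous_requestCost (hμ0 : ∀ᵐ x ∂μ, 0 ≤ x) (hg : Continuous g)
    (hgm : Monotone g) {F : ℝ → ℝ → ℝ≥0∞} (hF : LowerSemicontinuous fun p : ℝ × ℝ => F p.1 p.2)
    (hF0 : ∀ x, 0 ≤ x → F 0 x ≤ agePenalty g x) :
    LowerSemicontinuous fun p : ℝ × ℝ => requestCost μ g F p.1 p.2 := by
  intro p
  refine lowerSemicontinuousAt_iff_le_liminf.2 ?_
  have hmeas : ∀ q : ℝ × ℝ, Measurable fun x : ℝ =>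
      if x ≤ q.1 then F (q.1 - x) x else agePenalty g (max q.2 q.1) := fun q =>
    Measurable.ite measurableSet_Iic
      (hF.measurable.comp ((measurable_id.const_sub q.1).prodMk measurable_id)) measurable_const
  refine le_trans (lintegral_mono_ae ?_) (lintegral_liminf_le hmeas)
  filter_upwards [hμ0] with x hx
  refine (lowerSemicontinuousAt_iff_le_liminf (f := fun q : ℝ × ℝ =>
    if x ≤ q.1 then F (q.1 - x) x else agePenalty g (max q.2 q.1))).1 ?_
  have hpen : Continuous fun q : ℝ × ℝ => agePenalty g (max q.2 q.1) :=
    (continuous_agePenalty hg).comp (continuous_snd.max continuous_fst)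
  intro c hc
  dsimp only at hc ⊢
  rcases lt_or_ge p.1 x with hpx | hpx
  · rw [if_neg hpx.not_ge] at hc
    filter_upwards [continuous_fst.continuousAt.eventually_lt continuousAt_const hpx,
      continuousAt_const.eventually_lt hpen.continuousAt hc] with q hq hcq
    rwa [if_neg hq.not_ge]
  · rw [if_pos hpx] at hc
    have hcont : Continuous fun q : ℝ × ℝ => (q.1 - x, x) := by fun_prop
    have hF' := (hcont.tendsto p).eventually (hF (p.1 - x, x) c hc)
    rcases hpx.lt_or_eq with hlt | heq
    · filter_upwards [hF', continuousAt_const.eventually_lt continuous_fst.continuousAt hlt]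
        with q hcq hq
      rwa [if_pos hq.le]
    · have hc' : c < agePenalty g (max p.2 p.1) := by
        rw [← heq, sub_self] at hc
        exact hc.trans_le ((hF0 x hx).trans
          (monotone_agePenalty hgm (heq.le.trans (le_max_right _ _))))
      filter_upwards [hF', continuousAt_const.eventually_lt hpen.continuousAt hc'] with q h1 h2
      split_ifs
      exacts [h1, h2]

lemma valueIter_le_succ (hμ : ∀ᵐ x ∂μ, x ∈ Icc B_L B_U) (n : ℕ) (t y : ℝ) :
    valueIter μ g M n t y ≤ valueIter μ g M (n + 1) t y := by
  induction n generalizing t y with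
  | zero => exact zero_le
  | succ n ih =>
    exact iInf₂_mono fun z _ => requestCost_mono hμ fun x _ _ => ih _ _

/-- Each request uses up at least `B_L` of the remaining time, so the iteration is stationary once
`n * B_L` exceeds it. -/
lemma valueIter_succ_eq (hμ : ∀ᵐ x ∂μ, x ∈ Icc B_L B_U) {n : ℕ} {t : ℝ} (ht : 0 ≤ t)
    (htn : t < n * B_L) (y : ℝ) : valueIter μ g M (n + 1) t y = valueIter μ g M n t y := by
  induction n generalizing t y with
  | zero => simp at htn; linarith
  | succ n ih =>
    refine biInf_congr fun z hz => requestCost_congr hμ fun x hx hxs => ih (by linarith) ?_ _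
    push_cast at htn
    linarith [hz.1, hx.1]

lemma value_eq_valueIter (hBL : 0 ≤ B_L) (hμ : ∀ᵐ x ∂μ, x ∈ Icc B_L B_U) {n : ℕ} {t : ℝ}
    (ht : 0 ≤ t) (htn : t < n * B_L) (y : ℝ) : value μ g M t y = valueIter μ g M n t y := by
  have hmono : Monotone fun n => valueIter μ g M n t y :=
    monotone_nat_of_le_succ fun n => valueIter_le_succ hμ n t y
  refine le_antisymm (iSup_le fun m => ?_) (le_iSup (fun n => valueIter μ g M n t y) n)
  rcases le_total m n with hmn | hmn
  · exact hmono hmn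
  · induction m, hmn using Nat.le_induction with
    | base => exact le_rfl
    | succ m hmn ih =>
      rw [valueIter_succ_eq hμ ht (htn.trans_le (by gcongr))]
      exact ih

/-- The Bellman equation. -/
lemma value_eq (hBL : 0 < B_L) (hμ : ∀ᵐ x ∂μ, x ∈ Icc B_L B_U) {t : ℝ} (ht : 0 ≤ t) (y : ℝ) :
    value μ g M t y = ⨅ z ∈ Icc 0 M, requestCost μ g (value μ g M) (t - z) (y + t) := by
  obtain ⟨n, hn⟩ := exists_nat_gt (t / B_L)
  rw [div_lt_iff₀ hBL] at hn
  rw [value_eq_valueIter hBL.le hμ ht hn, ← valueIter_succ_eq hμ ht hn, valueIter]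
  refine biInf_congr fun z hz => requestCost_congr hμ fun x hx hxs => ?_
  exact (value_eq_valueIter hBL.le hμ (by linarith) (by linarith [hz.1, hx.1]) _).symm

lemma value_le (hBL : 0 < B_L) (hμ : ∀ᵐ x ∂μ, x ∈ Icc B_L B_U) {t y z : ℝ} (ht : 0 ≤ t)
    (hz : z ∈ Icc 0 M) :
    value μ g M t y ≤ requestCost μ g (value μ g M) (t - z) (y + t) := by
  rw [value_eq hBL hμ ht]
  exact iInf₂_le z hz

variable [IsProbabilityMeasure μ]

lemma value_zero_le (hBL : 0 < B_L) (hM : 0 ≤ M) (hμ : ∀ᵐ x ∂μ, x ∈ Icc B_L B_U) {y : ℝ}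
    (hy : 0 ≤ y) : value μ g M 0 y ≤ agePenalty g y := by
  refine (value_le hBL hμ le_rfl ⟨le_rfl, hM⟩).trans_eq ?_
  rw [requestCost_of_lt hμ _ (by simpa) (by simpa), add_zero]

lemma lowerSemicontinuous_value (hBL : 0 < B_L) (hM : 0 ≤ M) (hμ : ∀ᵐ x ∂μ, x ∈ Icc B_L B_U)
    (hg : Continuous g) (hgm : Monotone g) :
    LowerSemicontinuous fun p : ℝ × ℝ => value μ g M p.1 p.2 := by
  refine lowerSemicontinuous_iSup fun n => ?_
  induction n with
  | zero => exact lowerSemicontinuous_const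
  | succ n ih =>
    have hcost := lowerSemicontinuous_requestCost (hμ.mono fun x hx => hBL.le.trans hx.1) hg hgm ih
      fun x hx => (le_iSup (fun n => valueIter μ g M n 0 x) n).trans (value_zero_le hBL hM hμ hx)
    have hcont : Continuous fun q : (ℝ × ℝ) × ℝ => (q.1.1 - q.2, q.1.2 + q.1.1) := by fun_prop
    exact lowerSemicontinuous_biInf
      (Φ := fun q : (ℝ × ℝ) × ℝ =>
        requestCost μ g (valueIter μ g M n) (q.1.1 - q.2) (q.1.2 + q.1.1))
      (fun q c hc => (hcont.tendsto q).eventually (hcost _ c hc)) isCompact_Icc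

lemma lowerSemicontinuous_requestCost_value (hBL : 0 < B_L) (hM : 0 ≤ M)
    (hμ : ∀ᵐ x ∂μ, x ∈ Icc B_L B_U) (hg : Continuous g) (hgm : Monotone g) :
    LowerSemicontinuous fun p : ℝ × ℝ => requestCost μ g (value μ g M) p.1 p.2 :=
  lowerSemicontinuous_requestCost (hμ.mono fun _ hx => hBL.le.trans hx.1) hg hgm
    (lowerSemicontinuous_value hBL hM hμ hg hgm) fun _ hx => value_zero_le hBL hM hμ hx

/-- There is a decision function that always chooses the smallest optimal waiting period. -/
lemma exists_greedy (hBL : 0 < B_L) (hM : 0 ≤ M) (hμ : ∀ᵐ x ∂μ, x ∈ Icc B_L B_U)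
    (hg : Continuous g) (hgm : Monotone g) :
    ∃ z : SDPolicy M, ∀ t, 0 ≤ t → ∀ y,
      requestCost μ g (value μ g M) (t - z.z y t) (y + t) = value μ g M t y ∧
      ∀ z' ∈ Icc 0 M, requestCost μ g (value μ g M) (t - z') (y + t) ≤ value μ g M t y →
        z.z y t ≤ z' := by
  have hcont : Continuous fun q : (ℝ × ℝ) × ℝ => (q.1.2 - q.2, q.1.1 + q.1.2) := by fun_prop
  obtain ⟨f, hf, h⟩ := exists_measurable_smallest_minimizer
    (Φ := fun q : (ℝ × ℝ) × ℝ => requestCost μ g (value μ g M) (q.1.2 - q.2) (q.1.1 + q.1.2))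
    (fun q c hc => (hcont.tendsto q).eventually
      (lowerSemicontinuous_requestCost_value hBL hM hμ hg hgm _ c hc)) hM
  refine ⟨⟨fun y t => f (y, t), hf, fun y t => (h (y, t)).1⟩, fun t ht y => ?_⟩
  rw [value_eq hBL hμ ht]
  exact (h (y, t)).2

/-! ### Verification -/

/-- Induction on a bound for the number of deliveries before the query. The rule may use the whole
history, since what remains of it after one delivery is again a waiting rule. -/
lemma value_le_rulePenalty (hBL : 0 < B_L) (hμ : ∀ᵐ x ∂μ, x ∈ Icc B_L B_U) (hg : Continuous g)
    {w : ℕ → (ℕ → ℝ) → ℝ} (hw : IsWaitRule M w) {t y : ℝ} (ht : 0 ≤ t) (hy : 0 ≤ y) :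
    value μ g M t y ≤ rulePenalty μ g w t y := by
  obtain ⟨n, hn⟩ := exists_nat_gt (t / B_L)
  rw [div_lt_iff₀ hBL] at hn
  induction n generalizing w t y with
  | zero => simp at hn; linarith
  | succ n ih =>
    push_cast at hn
    have hw0 := hw.mem 0 (prepend y 0)
    refine (value_le hBL hμ ht hw0).trans ?_
    rw [rulePenalty_eq μ hg (hμ.mono fun x hx => hBL.le.trans hx.1) hw ht hy 0, requestCost,
      max_eq_left (by linarith [hw0.1])]
    refine lintegral_mono_ae ?_
    filter_upwards [hμ] with x hx
    split_ifs with hxt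
    · exact ih (hw.rest y) (by linarith) (hBL.le.trans hx.1) (by linarith [hw0.1, hx.1])
    · exact le_rfl

/-- For each fixed seed the policy is a deterministic waiting rule; averaging over the seed cannot
go below a common lower bound. -/
lemma value_le_expectedPenaltyFrom (hBL : 0 < B_L) (hμ : ∀ᵐ x ∂μ, x ∈ Icc B_L B_U)
    (hg : Continuous g) (π : CausalPolicy M) {t y : ℝ} (ht : 0 ≤ t) (hy : 0 ≤ y) :
    value μ g M t y ≤ expectedPenaltyFrom μ g π t y := by
  rw [expectedPenaltyFrom_eq μ hg π ht]
  calc value μ g M t y = ∫⁻ _ : unitInterval, value μ g M t y := by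
        rw [lintegral_const, measure_univ, mul_one]
    _ ≤ _ := lintegral_mono fun θ => value_le_rulePenalty hBL hμ hg (π.isWaitRule θ) ht hy

lemma lintegral_value_le_expectedPenalty (hBL : 0 < B_L) (hμ : ∀ᵐ x ∂μ, x ∈ Icc B_L B_U)
    (hg : Continuous g) (π : CausalPolicy M) {Q : ℝ} (hQ : 0 ≤ Q) :
    ∫⁻ y, value μ g M Q y ∂μ ≤ expectedPenalty μ g π Q := by
  rw [expectedPenalty_eq μ hg π hQ]
  calc ∫⁻ y, value μ g M Q y ∂μ = ∫⁻ _ : unitInterval, ∫⁻ y, value μ g M Q y ∂μ := by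
        rw [lintegral_const, measure_univ, mul_one]
    _ ≤ _ := lintegral_mono fun θ => lintegral_mono_ae <| hμ.mono fun y hy =>
        value_le_rulePenalty hBL hμ hg (π.isWaitRule θ) hQ (hBL.le.trans hy.1)

lemma costD_eq_rulePenalty (hg : Continuous g) (z : SDPolicy M) {t : ℝ} (ht : 0 ≤ t) (y : ℝ) :
    costD μ g z t y = rulePenalty μ g (markovRule (fun _ => z) t) t y :=
  expectedPenaltyFrom_ofRules μ hg _ ht y

lemma expectedPenalty_toCausal (hg : Continuous g) (z : SDPolicy M) {Q : ℝ} (hQ : 0 ≤ Q) :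
    expectedPenalty μ g (z.toCausal Q) Q = ∫⁻ y, costD μ g z Q y ∂μ := by
  rw [expectedPenalty_eq μ hg _ hQ]
  simp only [costD_eq_rulePenalty hg z hQ]
  exact (lintegral_const (∫⁻ y, rulePenalty μ g (markovRule (fun _ => z) Q) Q y ∂μ)).trans
    (by rw [measure_univ, mul_one])

lemma costD_eq_requestCost (hg : Continuous g) (hμ0 : ∀ᵐ x ∂μ, 0 ≤ x) (z : SDPolicy M)
    {t y : ℝ} (ht : 0 ≤ t) (hy : 0 ≤ y) :
    costD μ g z t y = requestCost μ g (costD μ g z) (t - z.z y t) (y + t) := by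
  rw [costD_eq_rulePenalty hg z ht, rulePenalty_markovRule μ hg hμ0 _ ht hy, requestCost,
    max_eq_left (by linarith [(z.z_mem y t).1])]
  refine lintegral_congr fun x => ?_
  split_ifs with hx
  · rw [costD_eq_rulePenalty hg z (by linarith)]
  · rfl

lemma costR_eq_requestCost (hg : Continuous g) (hμ0 : ∀ᵐ x ∂μ, 0 ≤ x) (z : SDPolicy M)
    {s a : ℝ} (hs : 0 ≤ s) (ha : 0 ≤ a) :
    costR μ g z s a = requestCost μ g (costD μ g z) s (a + s) := by
  set ζ : ℕ → SDPolicy M := fun j => if j = 0 then SDPolicy.noWait z.bound_nonneg else z with hζ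
  have h0 : (ζ 0).z a s = 0 := rfl
  have hsucc : (fun i => ζ (i + 1)) = fun _ => z := funext fun i => if_neg (Nat.succ_ne_zero i)
  rw [costR, SDPolicy.requestNow, ← hζ, expectedPenaltyFrom_ofRules μ hg _ hs,
    rulePenalty_markovRule μ hg hμ0 _ hs ha, requestCost, max_eq_left (by linarith), h0, hsucc,
    sub_zero]
  refine lintegral_congr fun x => ?_
  split_ifs with hx
  · rw [costD_eq_rulePenalty hg z (by linarith)]
  · rfl

lemma costD_eq_value_of_greedy (hBL : 0 < B_L) (hμ : ∀ᵐ x ∂μ, x ∈ Icc B_L B_U)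
    (hg : Continuous g) {z : SDPolicy M} (hz : ∀ t, 0 ≤ t → ∀ y,
      requestCost μ g (value μ g M) (t - z.z y t) (y + t) = value μ g M t y)
    {t y : ℝ} (ht : 0 ≤ t) (hy : 0 ≤ y) : costD μ g z t y = value μ g M t y := by
  obtain ⟨n, hn⟩ := exists_nat_gt (t / B_L)
  rw [div_lt_iff₀ hBL] at hn
  induction n generalizing t y with
  | zero => simp at hn; linarith
  | succ n ih =>
    push_cast at hn
    rw [costD_eq_requestCost hg (hμ.mono fun x hx => hBL.le.trans hx.1) z ht hy, ← hz t ht]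
    refine requestCost_congr hμ fun x hx hxs => ih (by linarith) (hBL.le.trans hx.1) ?_
    linarith [hx.1, (z.z_mem y t).1]

end

/-! ### The value far away from the query -/

/-- The smallest expected cost of a request with remaining time in `[B_U, 2 B_U]`. -/
def borderCost (μ : Measure ℝ) (g : ℝ≥0 → ℝ≥0) (B_U M : ℝ) : ℝ≥0∞ :=
  ⨅ s ∈ Icc B_U (2 * B_U), requestCost μ g (value μ g M) s 0

section

variable {μ : Measure ℝ} {g : ℝ≥0 → ℝ≥0} {B_L B_U M : ℝ}

lemma requestCost_age_irrel (hμ : ∀ᵐ x ∂μ, x ∈ Icc B_L B_U) (F : ℝ → ℝ → ℝ≥0∞) {s : ℝ}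
    (hs : B_U ≤ s) (τ τ' : ℝ) : requestCost μ g F s τ = requestCost μ g F s τ' := by
  rw [requestCost_of_le hμ _ hs, requestCost_of_le hμ _ hs]

/-- Requesting `B_U` earlier is no worse than a late request with age at least `B_U`. -/
lemma requestCost_add_le (hBL : 0 < B_L) (hM : B_U ≤ M) (hμ : ∀ᵐ x ∂μ, x ∈ Icc B_L B_U)
    [IsProbabilityMeasure μ] {s : ℝ} (hs : 0 ≤ s) (τ : ℝ) :
    requestCost μ g (value μ g M) (s + B_U) τ ≤
      requestCost μ g (value μ g M) s (s + B_U) := by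
  rw [requestCost_of_le hμ _ (by linarith)]
  calc ∫⁻ x, value μ g M (s + B_U - x) x ∂μ
      ≤ ∫⁻ _, requestCost μ g (value μ g M) s (s + B_U) ∂μ := by
        refine lintegral_mono_ae ?_
        filter_upwards [hμ] with x hx
        -- Waiting `B_U - x` after a delay `x` puts the second request at remaining time `s` and its
        -- fallback age at `s + B_U`, whatever `x` is.
        have h := value_le (μ := μ) (g := g) (M := M) (t := s + B_U - x) (y := x)
          (z := B_U - x) hBL hμ (by linarith [hx.2]) ⟨by linarith [hx.2], by linarith [hx.1]⟩
        rwa [show s + B_U - x - (B_U - x) = s by ring,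
          show x + (s + B_U - x) = s + B_U by ring] at h
    _ = _ := by rw [lintegral_const, measure_univ, mul_one]

lemma exists_requestCost_eq_borderCost [IsProbabilityMeasure μ] (hBL : 0 < B_L) (hBU : 0 ≤ B_U)
    (hM : 0 ≤ M) (hμ : ∀ᵐ x ∂μ, x ∈ Icc B_L B_U) (hg : Continuous g) (hgm : Monotone g) :
    ∃ s ∈ Icc B_U (2 * B_U), ∀ τ,
      requestCost μ g (value μ g M) s τ = borderCost μ g B_U M := by
  have hcont : Continuous fun s : ℝ => (s, (0 : ℝ)) := by fun_prop
  obtain ⟨s, hs, h⟩ := exists_eq_biInf (φ := fun s => requestCost μ g (value μ g M) s 0)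
    (fun s c hc => (hcont.tendsto s).eventually
      (lowerSemicontinuous_requestCost_value hBL hM hμ hg hgm _ c hc))
    (isCompact_Icc (a := B_U) (b := 2 * B_U)) (nonempty_Icc.2 (by linarith))
  exact ⟨s, hs, fun τ => (requestCost_age_irrel hμ _ hs.1 τ 0).trans h⟩

lemma borderCost_le_of_lt [IsProbabilityMeasure μ] (hBL : 0 < B_L) (hBU : 0 ≤ B_U) (hM : B_U ≤ M)
    (hμ : ∀ᵐ x ∂μ, x ∈ Icc B_L B_U) (hgm : Monotone g) {s τ : ℝ} (hs : s < B_U)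
    (hτ : 2 * B_U ≤ τ) : borderCost μ g B_U M ≤ requestCost μ g (value μ g M) s τ := by
  have h : ∀ s', 0 ≤ s' → s' < B_U →
      borderCost μ g B_U M ≤ requestCost μ g (value μ g M) s' τ := fun s' h0 h1 =>
    (iInf₂_le (s' + B_U) ⟨by linarith, by linarith⟩).trans
      ((requestCost_add_le hBL hM hμ h0 0).trans (requestCost_mono_age hgm _ _ (by linarith)))
  rcases le_or_gt 0 s with h0 | h0
  · exact h s h0 hs
  · rcases hBU.lt_or_eq with hpos | rfl
    -- A request after the query costs as much as one at the query: neither is delivered in time.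
    · refine (h 0 le_rfl hpos).trans_eq ?_
      rw [requestCost_of_lt hμ _ hBL (by linarith),
        requestCost_of_lt hμ _ (by linarith) (by linarith)]
    · obtain ⟨x, hx⟩ := hμ.exists
      linarith [hx.1, hx.2]

/-- Induction on a bound for the number of steps down to `2 B_U`. From `s ≥ 2 B_U` the next request
either still has `B_U` left, or jumps over the window with fallback age at least `x + (s - x) = s ≥
2 B_U`. -/
lemma borderCost_le_requestCost [IsProbabilityMeasure μ] (hBL : 0 < B_L) (hBU : 0 ≤ B_U)
    (hM : B_U ≤ M) (hμ : ∀ᵐ x ∂μ, x ∈ Icc B_L B_U) (hgm : Monotone g) {s : ℝ} (hs : B_U ≤ s)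
    (τ : ℝ) : borderCost μ g B_U M ≤ requestCost μ g (value μ g M) s τ := by
  obtain ⟨n, hn⟩ := exists_nat_gt ((s - 2 * B_U) / B_L)
  rw [div_lt_iff₀ hBL] at hn
  induction n generalizing s τ with
  | zero =>
    rw [requestCost_age_irrel hμ _ hs τ 0]
    exact iInf₂_le s ⟨hs, by simp at hn; linarith⟩
  | succ n ih =>
    push_cast at hn
    rcases le_total s (2 * B_U) with hs2 | hs2
    · rw [requestCost_age_irrel hμ _ hs τ 0]
      exact iInf₂_le s ⟨hs, hs2⟩
    rw [requestCost_of_le hμ _ hs]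
    calc borderCost μ g B_U M = ∫⁻ _, borderCost μ g B_U M ∂μ := by
          rw [lintegral_const, measure_univ, mul_one]
      _ ≤ _ := by
          refine lintegral_mono_ae ?_
          filter_upwards [hμ] with x hx
          rw [value_eq hBL hμ (by linarith [hx.2])]
          refine le_iInf₂ fun z hz => ?_
          rcases lt_or_ge (s - x - z) B_U with hlt | hge
          · exact borderCost_le_of_lt hBL hBU hM hμ hgm hlt (by linarith)
          · exact ih hge _ (by linarith [hx.1, hz.1])

lemma borderCost_le_value [IsProbabilityMeasure μ] (hBL : 0 < B_L) (hBU : 0 ≤ B_U)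
    (hM : B_U ≤ M) (hμ : ∀ᵐ x ∂μ, x ∈ Icc B_L B_U) (hgm : Monotone g) {t y : ℝ}
    (ht : 2 * B_U ≤ t) (hy : 0 ≤ y) : borderCost μ g B_U M ≤ value μ g M t y := by
  rw [value_eq hBL hμ (by linarith)]
  refine le_iInf₂ fun z hz => ?_
  rcases lt_or_ge (t - z) B_U with hlt | hge
  · exact borderCost_le_of_lt hBL hBU hM hμ hgm hlt (by linarith)
  · exact borderCost_le_requestCost hBL hBU hM hμ hgm hge _

lemma value_le_requestCost [IsProbabilityMeasure μ] (hBL : 0 < B_L) (hBU : 0 ≤ B_U)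
    (hM : B_U ≤ M) (hμ : ∀ᵐ x ∂μ, x ∈ Icc B_L B_U) {s : ℝ} (hs : B_U ≤ s) {t : ℝ}
    (hst : s ≤ t) (y τ : ℝ) : value μ g M t y ≤ requestCost μ g (value μ g M) s τ := by
  obtain ⟨n, hn⟩ := exists_nat_gt ((t - s) / B_L)
  rw [div_lt_iff₀ hBL] at hn
  induction n generalizing t y with
  | zero => simp at hn; linarith
  | succ n ih =>
    push_cast at hn
    rcases le_total t (s + B_U) with hle | hle
    · have h := value_le (μ := μ) (g := g) (M := M) (t := t) (y := y) (z := t - s) hBL hμ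
        (by linarith) ⟨by linarith, by linarith⟩
      rwa [sub_sub_cancel, requestCost_age_irrel hμ _ hs (y + t) τ] at h
    · refine (value_le (z := 0) hBL hμ (by linarith) ⟨le_rfl, by linarith⟩).trans ?_
      rw [sub_zero, requestCost_of_le hμ _ (by linarith)]
      calc ∫⁻ x, value μ g M (t - x) x ∂μ
          ≤ ∫⁻ _, requestCost μ g (value μ g M) s τ ∂μ := by
            refine lintegral_mono_ae ?_
            filter_upwards [hμ] with x hx
            exact ih (by linarith [hx.2]) x (by linarith [hx.1])
        _ = _ := by rw [lintegral_const, measure_univ, mul_one]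

/-- The optimal cost-to-go does not depend on the remaining time once it is at least `2 B_U`. -/
lemma value_eq_borderCost [IsProbabilityMeasure μ] (hBL : 0 < B_L) (hBU : 0 ≤ B_U)
    (hM : B_U ≤ M) (hμ : ∀ᵐ x ∂μ, x ∈ Icc B_L B_U) (hg : Continuous g) (hgm : Monotone g)
    {t y : ℝ} (ht : 2 * B_U ≤ t) (hy : 0 ≤ y) : value μ g M t y = borderCost μ g B_U M := by
  obtain ⟨s, hs, h⟩ :=
    exists_requestCost_eq_borderCost hBL hBU (hBU.trans hM) hμ hg hgm
  refine le_antisymm ?_ (borderCost_le_value hBL hBU hM hμ hgm ht hy)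
  rw [← h 0]
  exact value_le_requestCost hBL hBU hM hμ hs.1 (hs.2.trans ht) y 0

lemma requestCost_value_eq_borderCost [IsProbabilityMeasure μ] (hBL : 0 < B_L) (hBU : 0 ≤ B_U)
    (hM : B_U ≤ M) (hμ : ∀ᵐ x ∂μ, x ∈ Icc B_L B_U) (hg : Continuous g) (hgm : Monotone g)
    {s : ℝ} (hs : 3 * B_U ≤ s) (τ : ℝ) :
    requestCost μ g (value μ g M) s τ = borderCost μ g B_U M :=
  requestCost_const hμ (by linarith) τ fun x hx =>
    value_eq_borderCost hBL hBU hM hμ hg hgm (by linarith [hx.2]) (hBL.le.trans hx.1)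

lemma borderCost_ne_top [IsProbabilityMeasure μ] (hBL : 0 < B_L) (hBU : 0 ≤ B_U) (hM : B_U ≤ M)
    (hμ : ∀ᵐ x ∂μ, x ∈ Icc B_L B_U) : borderCost μ g B_U M ≠ ⊤ := by
  -- A request at the query itself with fallback age `B_U` costs the finite amount `g B_U`, and
  -- requesting `B_U` earlier is no worse.
  have h : borderCost μ g B_U M ≤ requestCost μ g (value μ g M) 0 (0 + B_U) :=
    (iInf₂_le (0 + B_U) ⟨by linarith, by linarith⟩).trans (requestCost_add_le hBL hM hμ le_rfl 0)
  rw [requestCost_of_lt hμ _ hBL (by linarith)] at h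
  exact ne_top_of_le_ne_top ENNReal.coe_ne_top h

/-! ### Optimal policies and border points -/

lemma singleQueryOpt_eq_borderCost [IsProbabilityMeasure μ] (hBL : 0 < B_L) (hBU : 0 ≤ B_U)
    (hM : B_U ≤ M) (hμ : ∀ᵐ x ∂μ, x ∈ Icc B_L B_U) (hg : Continuous g) (hgm : Monotone g)
    {z : SDPolicy M} (hz : ∀ t, 0 ≤ t → ∀ y, 0 ≤ y → costD μ g z t y = value μ g M t y)
    {Q : ℝ} (hQ : 2 * B_U ≤ Q) :
    singleQueryOpt μ g M Q = borderCost μ g B_U M ∧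
      expectedPenalty μ g (z.toCausal Q) Q = borderCost μ g B_U M := by
  have hQ0 : 0 ≤ Q := by linarith
  have hvalue : ∫⁻ y, value μ g M Q y ∂μ = borderCost μ g B_U M := by
    have h : ∀ᵐ y ∂μ, value μ g M Q y = borderCost μ g B_U M := hμ.mono fun y hy =>
      value_eq_borderCost hBL hBU hM hμ hg hgm hQ (hBL.le.trans hy.1)
    rw [lintegral_congr_ae h, lintegral_const, measure_univ, mul_one]
  have hcost : expectedPenalty μ g (z.toCausal Q) Q = borderCost μ g B_U M := by
    rw [expectedPenalty_toCausal hg z hQ0, ← hvalue]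
    exact lintegral_congr_ae (hμ.mono fun y hy => hz Q hQ0 y (hBL.le.trans hy.1))
  refine ⟨le_antisymm ((iInf_le _ (z.toCausal Q)).trans_eq hcost) (le_iInf fun π => ?_), hcost⟩
  rw [← hvalue]
  exact lintegral_value_le_expectedPenalty hBL hμ hg π hQ0

/-- Optimality compares `z` with policies rather than with `value`, so a policy `z₀` attaining
`value` serves as competitor. -/
lemma IsOptimal.costD_eq_value [IsProbabilityMeasure μ] (hBL : 0 < B_L)
    (hμ : ∀ᵐ x ∂μ, x ∈ Icc B_L B_U) (hg : Continuous g) {z₀ : SDPolicy M}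
    (hz₀ : ∀ t, 0 ≤ t → ∀ y, 0 ≤ y → costD μ g z₀ t y = value μ g M t y) {Q : ℝ}
    {z : SDPolicy M} (hz : IsOptimal μ g B_L B_U Q z) {t y : ℝ} (ht : t ∈ Icc 0 Q)
    (hy : y ∈ Icc B_L B_U) : costD μ g z t y = value μ g M t y := by
  have hy0 : 0 ≤ y := hBL.le.trans hy.1
  refine le_antisymm ?_ (value_le_expectedPenaltyFrom hBL hμ hg _ ht.1 hy0)
  rw [← hz₀ t ht.1 y hy0]
  exact hz.2 t ht y hy (z₀.toCausal t)

lemma IsOptimal.costR_eq_requestCost [IsProbabilityMeasure μ] (hBL : 0 < B_L)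
    (hμ : ∀ᵐ x ∂μ, x ∈ Icc B_L B_U) (hg : Continuous g) {z₀ : SDPolicy M}
    (hz₀ : ∀ t, 0 ≤ t → ∀ y, 0 ≤ y → costD μ g z₀ t y = value μ g M t y) {Q : ℝ}
    {z : SDPolicy M} (hz : IsOptimal μ g B_L B_U Q z) {s a : ℝ} (hs : s ∈ Icc 0 Q)
    (ha : 0 ≤ a) : costR μ g z s a = requestCost μ g (value μ g M) s (a + s) := by
  rw [PullOrWait.costR_eq_requestCost hg (hμ.mono fun x hx => hBL.le.trans hx.1) z hs.1 ha]
  exact requestCost_congr hμ fun x hx hxs =>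
    hz.costD_eq_value hBL hμ hg hz₀ ⟨by linarith, by linarith [hx.1, hs.2]⟩ hx

lemma IsOptimal.iInf_costR [IsProbabilityMeasure μ] (hBL : 0 < B_L) (hBU : 0 ≤ B_U)
    (hM : B_U ≤ M) (hμ : ∀ᵐ x ∂μ, x ∈ Icc B_L B_U) (hg : Continuous g) (hgm : Monotone g)
    {z₀ : SDPolicy M} (hz₀ : ∀ t, 0 ≤ t → ∀ y, 0 ≤ y → costD μ g z₀ t y = value μ g M t y)
    {Q : ℝ} (hQ : 2 * B_U ≤ Q) {z : SDPolicy M} (hz : IsOptimal μ g B_L B_U Q z) {a : ℝ}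
    (ha : 0 ≤ a) :
    ⨅ R ∈ Icc 0 (Q - B_U), costR μ g z (Q - R) a = borderCost μ g B_U M := by
  refine le_antisymm ?_ (le_iInf₂ fun R hR => ?_)
  · obtain ⟨s, hs, h⟩ :=
      exists_requestCost_eq_borderCost hBL hBU (hBU.trans hM) hμ hg hgm
    refine (iInf₂_le (Q - s) ⟨by linarith [hs.2], by linarith [hs.1]⟩).trans_eq ?_
    rw [sub_sub_cancel, hz.costR_eq_requestCost hBL hμ hg hz₀
      ⟨by linarith [hs.1], by linarith [hs.2]⟩ ha, h]
  · rw [hz.costR_eq_requestCost hBL hμ hg hz₀ ⟨by linarith [hR.2], by linarith [hR.1]⟩ ha]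
    exact borderCost_le_requestCost hBL hBU hM hμ hgm (by linarith [hR.2]) _

/-- The cost-to-go at the selected border point. -/
lemma IsOptimal.costR_borderPoint [IsProbabilityMeasure μ] (hBL : 0 < B_L) (hBLU : B_L ≤ B_U)
    (hM : B_U ≤ M) (hμ : ∀ᵐ x ∂μ, x ∈ Icc B_L B_U) (hg : Continuous g) (hgm : Monotone g)
    {z₀ : SDPolicy M} (hz₀ : ∀ t, 0 ≤ t → ∀ y, 0 ≤ y → costD μ g z₀ t y = value μ g M t y)
    {Q : ℝ} (hQ : 3 * B_U ≤ Q) {z : SDPolicy M} (hz : IsOptimal μ g B_L B_U Q z)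
    (hle : borderPoint B_L B_U Q z ≤ Q) :
    costR μ g z (Q - borderPoint B_L B_U Q z)
      (B_L + borderPoint B_L B_U Q z - (Q - 3 * B_U)) = borderCost μ g B_U M := by
  have hBU : 0 ≤ B_U := hBL.le.trans hBLU
  have hμ0 : ∀ᵐ x ∂μ, 0 ≤ x := hμ.mono fun x hx => hBL.le.trans hx.1
  have hz0 := (z.z_mem B_L (3 * B_U)).1
  -- The remaining time `3 B_U` lies in the range where the cost-to-go is constant, and that cost is
  -- the cost of the request `z` makes from there.
  have hD : costD μ g z (3 * B_U) B_L = borderCost μ g B_U M := by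
    rw [hz.costD_eq_value hBL hμ hg hz₀ ⟨by linarith, hQ⟩ ⟨le_rfl, hBLU⟩]
    exact value_eq_borderCost hBL hBU hM hμ hg hgm (by linarith) hBL.le
  rw [borderPoint] at hle ⊢
  rw [PullOrWait.costR_eq_requestCost hg hμ0 z (by linarith) (by linarith), ← hD,
    costD_eq_requestCost hg hμ0 z (by linarith) hBL.le]
  congr 1 <;> ring

end

end PullOrWait

end

theorem corollary3 (μ : MeasureTheory.Measure ℝ) [MeasureTheory.IsProbabilityMeasure μ]
    (B_L B_U M : ℝ) (hBL : 0 < B_L) (hμ : μ (Set.Icc B_L B_U) = 1) (hM : B_U ≤ M)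
    (g : ℝ≥0 → ℝ≥0) (hg_cont : Continuous g) (hg_mono : Monotone g) :
    -- one finite constant is the optimal value for all queries later than `3 B_U`
    ∃ h : ℝ≥0,
      (∀ Q, 3 * B_U < Q → PullOrWait.singleQueryOpt μ g M Q = h) ∧
      -- deterministic optimal policies exist, with selected border point in `[Q - 3 B_U, Q - B_U]`
      (∃ z : PullOrWait.SDPolicy M, ∀ Q, 3 * B_U < Q →
        PullOrWait.IsOptimal μ g B_L B_U Q z ∧
        PullOrWait.borderPoint B_L B_U Q z ∈ Set.Icc (Q - 3 * B_U) (Q - B_U)) ∧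
      -- for each of them the value is the cost-to-go at the border point
      (∀ Q, 3 * B_U < Q → ∀ z : PullOrWait.SDPolicy M, PullOrWait.IsOptimal μ g B_L B_U Q z →
        (PullOrWait.borderPoint B_L B_U Q z ≤ Q - B_U →
          PullOrWait.IsBorderPoint μ g B_U Q z (PullOrWait.borderPoint B_L B_U Q z)) ∧
        (∀ R, PullOrWait.IsBorderPoint μ g B_U Q z R →
          ∀ a, 0 ≤ a → PullOrWait.costR μ g z (Q - R) a = h) ∧
        (PullOrWait.borderPoint B_L B_U Q z ≤ Q →
          PullOrWait.costR μ g z (Q - PullOrWait.borderPoint B_L B_U Q z)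
            (B_L + PullOrWait.borderPoint B_L B_U Q z - (Q - 3 * B_U)) = h)) ∧
      -- the distance from the border point to the query does not depend on the query
      (∀ z : PullOrWait.SDPolicy M, ∀ Q Q', 3 * B_U < Q → 3 * B_U < Q' →
        Q - PullOrWait.borderPoint B_L B_U Q z = Q' - PullOrWait.borderPoint B_L B_U Q' z) := by
  open PullOrWait MeasureTheory Set in
  have hμ' : ∀ᵐ x ∂μ, x ∈ Icc B_L B_U := (prob_compl_eq_zero_iff measurableSet_Icc).2 hμ
  have hBLU : B_L ≤ B_U := by
    obtain ⟨x, hx⟩ := hμ'.exists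
    exact hx.1.trans hx.2
  have hBU : 0 ≤ B_U := hBL.le.trans hBLU
  have hM0 : 0 ≤ M := hBU.trans hM
  obtain ⟨z₀, hz₀⟩ := exists_greedy hBL hM0 hμ' hg_cont hg_mono
  have hcost₀ : ∀ t, 0 ≤ t → ∀ y, 0 ≤ y → costD μ g z₀ t y = value μ g M t y :=
    fun t ht y hy => costD_eq_value_of_greedy hBL hμ' hg_cont (fun t ht y => (hz₀ t ht y).1) ht hy
  -- Requesting at once is already optimal with `3 B_U` left, so the smallest optimal waiting period
  -- is zero. An arbitrary optimal choice might overshoot `Q - B_U`.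
  have hwait₀ : z₀.z B_L (3 * B_U) = 0 := by
    refine le_antisymm ((hz₀ (3 * B_U) (by linarith) B_L).2 0 ⟨le_rfl, hM0⟩ ?_) (z₀.z_mem _ _).1
    rw [sub_zero, requestCost_value_eq_borderCost hBL hBU hM hμ' hg_cont hg_mono le_rfl]
    exact borderCost_le_value hBL hBU hM hμ' hg_mono (by linarith) hBL.le
  refine ⟨(borderCost μ g B_U M).toNNReal, ?_⟩
  rw [ENNReal.coe_toNNReal (borderCost_ne_top hBL hBU hM hμ')]
  refine ⟨fun Q hQ => ?_, ⟨z₀, fun Q hQ => ⟨⟨?_, fun t ht y hy π => ?_⟩, ?_⟩⟩,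
    fun Q hQ z hz => ⟨fun hle => ⟨⟨?_, hle⟩, fun a ha => ?_⟩, fun R hR a ha => ?_, fun hle => ?_⟩,
    fun z Q Q' _ _ => ?_⟩
  · exact (singleQueryOpt_eq_borderCost hBL hBU hM hμ' hg_cont hg_mono hcost₀ (by linarith)).1
  · have h := singleQueryOpt_eq_borderCost hBL hBU hM hμ' hg_cont hg_mono hcost₀
      (Q := Q) (by linarith)
    rw [h.1, h.2]
  · rw [hcost₀ t ht.1 y (hBL.le.trans hy.1)]
    exact value_le_expectedPenaltyFrom hBL hμ' hg_cont π ht.1 (hBL.le.trans hy.1)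
  · rw [borderPoint, hwait₀]
    constructor <;> linarith
  · rw [borderPoint]
    linarith [(z.z_mem B_L (3 * B_U)).1]
  · have hz0 := (z.z_mem B_L (3 * B_U)).1
    have hs : Q - borderPoint B_L B_U Q z ∈ Icc 0 Q := by
      rw [borderPoint] at hle ⊢
      constructor <;> linarith
    rw [hz.iInf_costR hBL hBU hM hμ' hg_cont hg_mono hcost₀ (by linarith) ha,
      ← hz.costR_borderPoint hBL hBLU hM hμ' hg_cont hg_mono hcost₀ hQ.le (by linarith),
      hz.costR_eq_requestCost hBL hμ' hg_cont hcost₀ hs ha,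
      hz.costR_eq_requestCost hBL hμ' hg_cont hcost₀ hs (by rw [borderPoint]; linarith)]
    -- The cost is known at the actual age of the selected request; with at least `B_U` left it is
    -- the same at every age `a`.
    exact requestCost_age_irrel hμ' _ (by linarith) _ _
  · rw [hR.2 a ha, hz.iInf_costR hBL hBU hM hμ' hg_cont hg_mono hcost₀ (by linarith) ha]
  · exact hz.costR_borderPoint hBL hBLU hM hμ' hg_cont hg_mono hcost₀ hQ.le hle
  · simp only [borderPoint]
    ring
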